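/- Let $G$ be a finite simple graph. A set $S\subseteq V(G)$ is a \emph{total dominating set} if every vertex of $G$ has a neighbour in $S$. A \emph{thoroughly distributed family} $\mathcal F$ of $G$ is a nonempty finite family of (not necessarily distinct) total dominating sets of $G$; $r_{\mathcal F}$ denotes the maximum number of times that any vertex of $G$ appears in $\mathcal F$. The \emph{fractional total domatic number} of $G$ is $$\mathrm{FTD}(G)=\sup_{\mathcal F}\frac{|\mathcal F|}{r_{\mathcal F}},$$ the supremum being over all thoroughly distributed families of $G$. A \emph{triangulated disc} is a finite simple connected graph with at least three vertices that can be embedded in the plane so that the outer face is bounded by a cycle and every bounded face is a triangle. Theorem. Every triangulated disc $G$ satisfies $\mathrm{FTD}(G)\ge \tfrac32$. Moreover, this is best possible: for every $N$ there is a triangulated disc $G$ with at least $N$ vertices and $\mathrm{FTD}(G)=\tfrac32$. -/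

import Mathlib

open scoped ENNReal

namespace SimpleGraph

/-- A combinatorial embedding (rotation system) of `G`: a permutation of the darts (oriented edges)
which, around each vertex `v`, cyclically permutes the darts that start at `v`. -/
structure RotationSystem {V : Type*} (G : SimpleGraph V) where
  rot : Equiv.Perm G.Dart
  rot_fst : ∀ d : G.Dart, (rot d).fst = d.fst
  rot_sameCycle : ∀ d e : G.Dart, d.fst = e.fst → rot.SameCycle d e

namespace RotationSystem

variable {V : Type*} {G : SimpleGraph V}

/-- Facial walk: after traversing the dart `d` from `u` to `v`, continue with the dart which follows
the reversed dart (from `v` to `u`) in the rotation at `v`. -/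
def faceNext (R : RotationSystem G) : Equiv.Perm G.Dart :=
  (Function.Involutive.toPerm SimpleGraph.Dart.symm SimpleGraph.Dart.symm_involutive).trans R.rot

/-- The faces are the orbits of `faceNext`; each is represented by its boundary walk. -/
def Face (R : RotationSystem G) : Type _ :=
  Quotient (Equiv.Perm.SameCycle.setoid R.faceNext)

/-- The embedding of a connected graph with at least one edge is an embedding in the plane
(equivalently, in the sphere): Euler's formula `|V| - |E| + |F| = 2` holds, that is, the genus of
the surface obtained by gluing a disc to each facial walk is zero. -/
def IsPlanar (R : RotationSystem G) : Prop :=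
  Nat.card V + Nat.card R.Face = Nat.card G.edgeSet + 2

/-- The boundary walk of the face to the side of `o` visits no vertex twice. -/
def IsSimpleFace (R : RotationSystem G) (o : G.Dart) : Prop :=
  ∀ d e : G.Dart, R.faceNext.SameCycle o d → R.faceNext.SameCycle o e → d.fst = e.fst → d = e

/-- The face to the side of `d` is a triangle: its boundary walk closes up after three steps
(it cannot close up after one step, since `G` has no loops). -/
def IsTriangularFace (R : RotationSystem G) (d : G.Dart) : Prop :=
  R.faceNext (R.faceNext (R.faceNext d)) = d

end RotationSystem

/-- A triangulated disc: a connected simple graph with at least three vertices that has an embedding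
in the plane such that the boundary of the outer face (the face of the dart `o`) is a cycle and all
other faces are triangles. -/
def IsTriangulatedDisc {V : Type*} (G : SimpleGraph V) : Prop :=
  G.Connected ∧ 3 ≤ Nat.card V ∧
    ∃ R : RotationSystem G, R.IsPlanar ∧ ∃ o : G.Dart, R.IsSimpleFace o ∧
      ∀ d : G.Dart, ¬ R.faceNext.SameCycle o d → R.IsTriangularFace d

/-- `S` is a total dominating set of `G`: every vertex has a neighbour in `S`. -/
def IsTotalDominating {V : Type*} (G : SimpleGraph V) (S : Finset V) : Prop :=
  ∀ v : V, ∃ w ∈ S, G.Adj v w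

/-- A thoroughly distributed family of `G`: a nonempty finite family of (not necessarily distinct)
total dominating sets of `G`. -/
def IsThoroughlyDistributed {V : Type*} (G : SimpleGraph V) (F : Multiset (Finset V)) : Prop :=
  F ≠ 0 ∧ ∀ S ∈ F, G.IsTotalDominating S

/-- The maximum number of times that a vertex appears in the family `F`. -/
def maxAppearances {V : Type*} [Fintype V] [DecidableEq V] (F : Multiset (Finset V)) : ℕ :=
  Finset.univ.sup fun v : V => F.countP fun S => v ∈ S

/-- The fractional total domatic number of `G`: the supremum of the effective ratio `|F| / r_F` over
all thoroughly distributed families `F` of `G`. It is taken in `[0, ∞]`, where every set has a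
supremum. -/
noncomputable def fractionalTotalDomaticNumber {V : Type*} [Fintype V] [DecidableEq V]
    (G : SimpleGraph V) : ℝ≥0∞ :=
  ⨆ (F : Multiset (Finset V)) (_ : G.IsThoroughlyDistributed F),
    (Multiset.card F : ℝ≥0∞) / (maxAppearances F : ℝ≥0∞)

end SimpleGraph

namespace SimpleGraph

/-! ### Darts, rotations and facial walks -/

namespace RotationSystem

variable {V : Type*} {G : SimpleGraph V}

/-! Lower bound: it suffices to colour the vertices with `ZMod 3` so that every open neighbourhood
shows two colours. The complements of the three colour classes are then total dominating, and each
vertex lies in exactly two of them, which gives the ratio 3/2.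

The colouring is found through its differences along darts. One seeks an antisymmetric `δ` with sum
zero around each bounded triangle such that every vertex is opposite, in some triangle, to an edge
with `δ ≠ 0`; the ends of that edge are differently coloured neighbours. Such a `δ` is a coboundary
because the embedding is planar: Euler's formula supplies exactly the dimension count needed
(`IsPlanar.exists_eq_sub`).

The cochain is built by induction on the set of triangles (`exists_isGoodCochain`): a fan at a
boundary vertex is removed, and the cochain of the remainder is extended over it
(`IsFan.exists_isGoodCochain`). The induction carries the stronger demand that `δ` is nonzero on
boundary edges. Over three elements the few forbidden values always leave a choice.

Sharpness: a triangle with an ear on each side. The tip of each ear has only two neighbours, so a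
total dominating set contains two of the three corners; counting corners bounds the ratio by 3/2.
Extra vertices inside the triangle make the graph arbitrarily large. -/

lemma faceNext_apply (R : RotationSystem G) (d : G.Dart) : R.faceNext d = R.rot d.symm := rfl

lemma faceNext_fst (R : RotationSystem G) (d : G.Dart) : (R.faceNext d).fst = d.snd := by
  rw [faceNext_apply, R.rot_fst]; rfl

lemma rot_symm_fst (R : RotationSystem G) (d : G.Dart) : (R.rot.symm d).fst = d.fst := by
  rw [← R.rot_fst, Equiv.apply_symm_apply]

lemma faceNext_rot_symm (R : RotationSystem G) (d : G.Dart) :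
    R.faceNext (R.rot.symm d).symm = d := by
  rw [faceNext_apply, Dart.symm_symm, Equiv.apply_symm_apply]

/-- In a triangular face, the third dart is the reverse of the previous dart in the rotation. -/
lemma IsTriangularFace.faceNext_faceNext {R : RotationSystem G} {d : G.Dart}
    (h : R.IsTriangularFace d) : R.faceNext (R.faceNext d) = (R.rot.symm d).symm := by
  apply R.faceNext.injective
  rw [faceNext_rot_symm]
  exact h

/-- A property of darts which is invariant under reversal and under the facial walk, and which holds
for one dart of a connected graph, holds for all darts. -/
lemma forall_dart_of_invariant [Finite V] (R : RotationSystem G) (hG : G.Connected)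
    {P : G.Dart → Prop} (hsymm : ∀ d, P d → P d.symm) (hnext : ∀ d, P d → P (R.faceNext d))
    {d₀ : G.Dart} (h₀ : P d₀) (d : G.Dart) : P d := by
  classical
  have : Fintype V := Fintype.ofFinite V
  have hrot : ∀ d, P d → P (R.rot d) := fun d hd => by
    simpa [faceNext_apply] using hnext _ (hsymm _ hd)
  have hcyc : ∀ d e : G.Dart, d.fst = e.fst → P d → P e := by
    intro d e hde hd
    obtain ⟨n, -, rfl⟩ := (R.rot_sameCycle d e hde).exists_pow_eq'
    clear hde
    induction n with
    | zero => simpa using hd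
    | succ n ih => rw [pow_succ', Equiv.Perm.mul_apply]; exact hrot _ ih
  have key : ∀ u v : V, G.Walk u v → (∃ e : G.Dart, e.fst = u ∧ P e) →
      ∃ e : G.Dart, e.fst = v ∧ P e := by
    intro u v p
    induction p with
    | nil => exact id
    | cons h p ih =>
      rintro ⟨e, he, hP⟩
      apply ih
      exact ⟨(Dart.mk (_, _) h).symm, rfl, hsymm _ (hcyc e _ he hP)⟩
  obtain ⟨p⟩ := hG.preconnected d₀.fst d.fst
  obtain ⟨e, he, hP⟩ := key _ _ p ⟨d₀, rfl, h₀⟩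
  exact hcyc e d he hP

/-- An antisymmetric function on darts can be prescribed on any set of darts which contains no dart
together with its reverse. -/
lemma exists_antisymm_update {A : Type*} [AddCommGroup A] (δ' : G.Dart → A)
    (hδ' : ∀ d, δ' d.symm = -δ' d) (E : Set G.Dart) (hE : ∀ d ∈ E, d.symm ∉ E)
    (h : G.Dart → A) :
    ∃ δ : G.Dart → A, (∀ d, δ d.symm = -δ d) ∧ (∀ d ∈ E, δ d = h d) ∧
      ∀ d, d ∉ E → d.symm ∉ E → δ d = δ' d := by
  classical
  refine ⟨fun d => if d ∈ E then h d else if d.symm ∈ E then -h d.symm else δ' d, ?_, ?_, ?_⟩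
  · intro d
    by_cases h1 : d ∈ E
    · simp [h1, hE d h1]
    · by_cases h2 : d.symm ∈ E <;> simp [h1, h2, hδ']
  · intro d hd; simp [hd]
  · intro d h1 h2; simp [h1, h2]

/-! ### Good cochains and their extension over fans -/

/-- The cochains which are used to colour the vertices: `δ` is antisymmetric, sums to zero along
each triangle of `S`, does not vanish on the boundary of `S`, and each vertex of `S` is
opposite to some edge of a triangle of `S` on which `δ` does not vanish. -/
structure IsGoodCochain (R : RotationSystem G) (S : Finset G.Dart) (δ : G.Dart → ZMod 3) :
    Prop where
  antisymm : ∀ d, δ d.symm = -δ d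
  closed : ∀ d ∈ S, δ d + δ (R.faceNext d) + δ (R.faceNext (R.faceNext d)) = 0
  boundary : ∀ d ∈ S, d.symm ∉ S → δ d ≠ 0
  opposite : ∀ d ∈ S, ∃ e ∈ S, e.fst = d.fst ∧ δ (R.faceNext e) ≠ 0

/-- The numbers assigned to the edges of a fan, see `IsFan.exists_isGoodCochain`. -/
lemma exists_fan_values (b : ℕ) (s : ℕ → ZMod 3) (w : ZMod 3) (linkAlive lastAlive : Prop)
    (hs : linkAlive → s b ≠ 0) (hw : lastAlive → w ≠ 0) (hlw : ¬ (linkAlive ∧ lastAlive)) :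
    ∃ g : ℕ → ZMod 3, g 0 ≠ 0 ∧ g (b + 1) ≠ 0 ∧ g (b + 1) ≠ g b ∧
      (∀ i < b, g i + s i = g (i + 1)) ∧ (linkAlive → g b + s b = g (b + 1)) ∧
      (lastAlive → g (b + 1) = w) ∧ (¬ linkAlive → ¬ lastAlive → g b ≠ 0) := by
  -- With three elements, two forbidden values leave a third.
  have two : ∀ x y : ZMod 3, ∃ l : ZMod 3, l ≠ 0 ∧ l + x ≠ y := by decide
  have avoid : ∀ x y : ZMod 3, ∃ l : ZMod 3, l ≠ x ∧ l ≠ y := by decide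
  set t : ZMod 3 := ∑ j ∈ Finset.range b, s j with ht
  -- Here `l` is the value on the first spoke and `z` that on the last. The spokes in between are
  -- forced to be `l` plus partial sums of the links, so that `l + t` is the value on spoke `b`.
  suffices h : ∃ l z : ZMod 3, l ≠ 0 ∧ z ≠ 0 ∧ z ≠ l + t ∧ (linkAlive → l + t + s b = z) ∧
      (lastAlive → z = w) ∧ (¬ linkAlive → ¬ lastAlive → l + t ≠ 0) by
    obtain ⟨l, z, h0, h1, h2, h3, h4, h5⟩ := h
    refine ⟨fun i => if i = b + 1 then z else l + ∑ j ∈ Finset.range i, s j, ?_, ?_, ?_, ?_, ?_, ?_,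
      ?_⟩
    · simpa using h0
    · simpa using h1
    · simpa using h2
    · intro i hi
      beta_reduce
      rw [if_neg (by omega), if_neg (by omega), Finset.sum_range_succ, add_assoc]
    · simpa using h3
    · simpa using h4
    · simpa using h5
  by_cases hl : linkAlive
  · have hla : ¬ lastAlive := fun h => hlw ⟨hl, h⟩
    obtain ⟨l, h1, h2⟩ := two (t + s b) 0
    refine ⟨l, l + t + s b, h1, by rwa [add_assoc], ?_, fun _ => rfl, fun h => absurd h hla,
      fun h => absurd hl h⟩
    simpa using hs hl
  · by_cases hla : lastAlive
    · obtain ⟨l, h1, h2⟩ := two t w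
      exact ⟨l, w, h1, hw hla, h2.symm, fun h => absurd h hl, fun _ => rfl,
        fun _ h => absurd hla h⟩
    · obtain ⟨l, h1, h2⟩ := two t 0
      obtain ⟨z, h3, h4⟩ := avoid 0 (l + t)
      exact ⟨l, z, h1, h3, h4, fun h => absurd h hl, fun h => absurd h hla, fun _ _ => h2⟩

/-- A *fan* in a set `S` of darts: triangles of `S` around a vertex which are consecutive in
the rotation, starting at a boundary dart `e 0` of `S` and stopping at the first triangle of which
another edge lies on the boundary of `S`. -/
structure IsFan (R : RotationSystem G) (S : Finset G.Dart) (e : ℕ → G.Dart) (b : ℕ) : Prop where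
  symm_zero_notMem : (e 0).symm ∉ S
  succ : ∀ i, e (i + 1) = R.rot.symm (e i)
  mem : ∀ i ≤ b, e i ∈ S
  link_mem : ∀ i < b, (R.faceNext (e i)).symm ∈ S
  maximal : ¬ ((R.faceNext (e b)).symm ∈ S ∧ e (b + 1) ∈ S)

/-- The rotation about the tail of `d₀` must stop: a full turn inside `S` would return to `d₀` and
show `d₀.symm` as the third dart of a triangle of `S`. -/
lemma exists_isFan [Finite V] (R : RotationSystem G) {S : Finset G.Dart}
    (hnext : ∀ d ∈ S, R.faceNext d ∈ S) (htri : ∀ d ∈ S, R.IsTriangularFace d)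
    {d₀ : G.Dart} (h₀ : d₀ ∈ S) (h₀' : d₀.symm ∉ S) : ∃ e b, R.IsFan S e b := by
  classical
  have : Fintype V := Fintype.ofFinite V
  set e : ℕ → G.Dart := fun i => ((R.rot⁻¹ : Equiv.Perm G.Dart) ^ i) d₀ with he
  have hzero : e 0 = d₀ := rfl
  have hsucc : ∀ i, e (i + 1) = R.rot.symm (e i) := fun i => by
    simp only [he, pow_succ', Equiv.Perm.mul_apply]; rfl
  have hex : ∃ b, ¬ ((R.faceNext (e b)).symm ∈ S ∧ e (b + 1) ∈ S) := by
    by_contra! hcon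
    have hpos := orderOf_pos (R.rot⁻¹ : Equiv.Perm G.Dart)
    have hret : e (orderOf (R.rot⁻¹ : Equiv.Perm G.Dart) - 1 + 1) = d₀ := by
      rw [Nat.sub_add_cancel hpos]
      simp only [he, pow_orderOf_eq_one, Equiv.Perm.one_apply]
    have hmem : ∀ i, e i ∈ S := by
      rintro (_ | i)
      · exact h₀
      · exact (hcon i).2
    apply h₀'
    rw [← hret, hsucc, ← (htri _ (hmem _)).faceNext_faceNext]
    exact hnext _ (hnext _ (hmem _))
  refine ⟨e, Nat.find hex, ⟨h₀', hsucc, ?_, ?_, Nat.find_spec hex⟩⟩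
  · rintro (_ | i) hi
    · exact h₀
    · exact (not_not.1 (Nat.find_min hex (m := i) (by omega))).2
  · intro i hi
    exact (not_not.1 (Nat.find_min hex hi)).1

section Fan

variable {R : RotationSystem G} {S : Finset G.Dart} {e : ℕ → G.Dart} {b : ℕ}

lemma IsFan.fst_eq (hF : R.IsFan S e b) (i : ℕ) : (e i).fst = (e 0).fst := by
  induction i with
  | zero => rfl
  | succ i ih => rw [hF.succ, rot_symm_fst, ih]

lemma IsFan.third (hF : R.IsFan S e b) (htri : ∀ d ∈ S, R.IsTriangularFace d) {i : ℕ}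
    (hi : i ≤ b) : R.faceNext (R.faceNext (e i)) = (e (i + 1)).symm := by
  rw [(htri _ (hF.mem i hi)).faceNext_faceNext, hF.succ]

/-- Rotating two equal spokes back would identify `e 0` with a later spoke, whose reverse is the
third dart of a fan triangle and hence in `S`. -/
lemma IsFan.injOn (hF : R.IsFan S e b) (hnext : ∀ d ∈ S, R.faceNext d ∈ S)
    (htri : ∀ d ∈ S, R.IsTriangularFace d) {i j : ℕ} (hi : i ≤ b + 1) (hj : j ≤ b + 1)
    (hij : e i = e j) : i = j := by
  have key : ∀ k i, i + k + 1 ≤ b + 1 → e i ≠ e (i + k + 1) := by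
    intro k i
    induction i with
    | zero =>
      intro hk h
      apply hF.symm_zero_notMem
      rw [h, ← hF.third htri (by omega)]
      exact hnext _ (hnext _ (hF.mem _ (by omega)))
    | succ i ih =>
      intro hk h
      refine ih (by omega) (R.rot.symm.injective ?_)
      rw [← hF.succ, ← hF.succ, h]
      congr 1
      omega
  rcases lt_trichotomy i j with h | h | h
  · obtain ⟨k, rfl⟩ := Nat.exists_eq_add_of_lt h
    exact absurd hij (key _ _ hj)
  · exact h
  · obtain ⟨k, rfl⟩ := Nat.exists_eq_add_of_lt h
    exact absurd hij.symm (key _ _ hi)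

lemma IsFan.snd_inj (hF : R.IsFan S e b) (hnext : ∀ d ∈ S, R.faceNext d ∈ S)
    (htri : ∀ d ∈ S, R.IsTriangularFace d) {i j : ℕ} (hi : i ≤ b + 1) (hj : j ≤ b + 1)
    (hij : (e i).snd = (e j).snd) : i = j := by
  refine hF.injOn hnext htri hi hj (Dart.ext _ _ (Prod.ext ?_ hij))
  exact (hF.fst_eq i).trans (hF.fst_eq j).symm

lemma IsFan.link_snd (hF : R.IsFan S e b) (htri : ∀ d ∈ S, R.IsTriangularFace d) {i : ℕ}
    (hi : i ≤ b) : (R.faceNext (e i)).snd = (e (i + 1)).snd := by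
  rw [← faceNext_fst, hF.third htri hi]; rfl

lemma IsFan.snd_ne (hF : R.IsFan S e b) (i : ℕ) : (e i).snd ≠ (e 0).fst := by
  rw [← hF.fst_eq i]; exact (e i).adj.ne'

/-- The darts of the triangles of a fan. -/
def fanDarts (R : RotationSystem G) (e : ℕ → G.Dart) (b : ℕ) : Set G.Dart :=
  {d | ∃ i ≤ b, d = e i ∨ d = R.faceNext (e i) ∨ d = R.faceNext (R.faceNext (e i))}

lemma IsFan.faceNext_mem_fanDarts (hF : R.IsFan S e b) (htri : ∀ d ∈ S, R.IsTriangularFace d)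
    {d : G.Dart} (hd : d ∈ R.fanDarts e b) : R.faceNext d ∈ R.fanDarts e b := by
  obtain ⟨i, hi, rfl | rfl | rfl⟩ := hd
  · exact ⟨i, hi, Or.inr (Or.inl rfl)⟩
  · exact ⟨i, hi, Or.inr (Or.inr rfl)⟩
  · exact ⟨i, hi, Or.inl (htri _ (hF.mem i hi))⟩

lemma IsFan.faceNext_notMem_fanDarts (hF : R.IsFan S e b) (htri : ∀ d ∈ S, R.IsTriangularFace d)
    {d : G.Dart} (hdS : d ∈ S) (hd : d ∉ R.fanDarts e b) : R.faceNext d ∉ R.fanDarts e b :=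
  fun h => hd <| by
    have := hF.faceNext_mem_fanDarts htri (hF.faceNext_mem_fanDarts htri h)
    rwa [htri d hdS] at this

/-- The edge of a fan triangle opposite to the centre is not shared with another fan triangle. -/
lemma IsFan.link_symm_notMem (hF : R.IsFan S e b) (hnext : ∀ d ∈ S, R.faceNext d ∈ S)
    (htri : ∀ d ∈ S, R.IsTriangularFace d) {i : ℕ} (hi : i ≤ b) :
    (R.faceNext (e i)).symm ∉ R.fanDarts e b := by
  have hfst : (R.faceNext (e i)).symm.fst = (e (i + 1)).snd := hF.link_snd htri hi
  have hsnd : (R.faceNext (e i)).symm.snd = (e i).snd := R.faceNext_fst _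
  rintro ⟨j, hj, h | h | h⟩
  · rw [h, hF.fst_eq] at hfst
    exact hF.snd_ne _ hfst.symm
  · have h1 : (e j).snd = (e (i + 1)).snd := by rw [← hfst, h, faceNext_fst]
    have h2 : (e (j + 1)).snd = (e i).snd := by rw [← hsnd, h, hF.link_snd htri hj]
    have := hF.snd_inj hnext htri (by omega) (by omega) h1
    have := hF.snd_inj hnext htri (by omega) (by omega) h2
    omega
  · rw [h, hF.third htri hj] at hsnd
    exact hF.snd_ne i (hsnd.symm.trans (hF.fst_eq _))

/-- A good cochain on the complement of a fan can be modified to a good cochain. -/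
lemma IsFan.exists_isGoodCochain (hF : R.IsFan S e b) (hnext : ∀ d ∈ S, R.faceNext d ∈ S)
    (htri : ∀ d ∈ S, R.IsTriangularFace d) {S' : Finset G.Dart}
    (hS' : ∀ d, d ∈ S' ↔ d ∈ S ∧ d ∉ R.fanDarts e b) {δ' : G.Dart → ZMod 3}
    (hδ' : R.IsGoodCochain S' δ') : ∃ δ, R.IsGoodCochain S δ := by
  classical
  have hsymm_inj : ∀ {d d' : G.Dart}, d.symm = d'.symm → d = d' :=
    fun h => Dart.symm_involutive.injective h
  have hlink_alive : ∀ i ≤ b, (R.faceNext (e i)).symm ∈ S → (R.faceNext (e i)).symm ∈ S' :=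
    fun i hi h => (hS' _).2 ⟨h, hF.link_symm_notMem hnext htri hi⟩
  have hlast_fan : e (b + 1) ∉ R.fanDarts e b := by
    rintro ⟨i, hi, h | h | h⟩
    · have := hF.injOn hnext htri (by omega) (by omega) h
      omega
    · have h1 : (R.faceNext (e i)).fst = (e 0).fst := by rw [← h, hF.fst_eq]
      rw [faceNext_fst] at h1
      exact hF.snd_ne _ h1
    · have h1 : (e (b + 1)).fst = (e (i + 1)).snd := by rw [h, hF.third htri hi]; rfl
      rw [hF.fst_eq] at h1
      exact hF.snd_ne _ h1.symm
  have hlast_alive : e (b + 1) ∈ S → e (b + 1) ∈ S' := fun h => (hS' _).2 ⟨h, hlast_fan⟩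
  -- the values along the fan
  obtain ⟨g, g0, gb, gne, gstep, glink, glast, gdead⟩ :=
    exists_fan_values b (fun i => δ' (R.faceNext (e i))) (δ' (e (b + 1)))
      ((R.faceNext (e b)).symm ∈ S) (e (b + 1) ∈ S)
      -- A surviving edge has one side in the fan and the other in `S'`, so it is a boundary edge of
      -- `S'` and `δ'` is nonzero there.
      (fun h h0 => by
        refine hδ'.boundary _ (hlink_alive b le_rfl h) ?_ (by rw [hδ'.antisymm, h0, neg_zero])
        rw [Dart.symm_symm, hS']
        exact fun h' => h'.2 ⟨b, le_rfl, Or.inr (Or.inl rfl)⟩)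
      (fun h => hδ'.boundary _ (hlast_alive h) (by
        rw [hS', ← hF.third htri le_rfl]
        exact fun h' => h'.2 ⟨b, le_rfl, Or.inr (Or.inr rfl)⟩))
      hF.maximal
  -- the modified cochain
  obtain ⟨h, hh⟩ : ∃ h : G.Dart → ZMod 3, ∀ i ≤ b + 1, h (e i) = g i := by
    refine ⟨fun d => if hd : ∃ i ≤ b + 1, e i = d then g hd.choose else 0, fun i hi => ?_⟩
    have hex : ∃ j ≤ b + 1, e j = e i := ⟨i, hi, rfl⟩
    simp only [dif_pos hex]
    rw [hF.injOn hnext htri hex.choose_spec.1 hi hex.choose_spec.2]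
  set f := R.faceNext (e b) with hf
  have hf1 : f.fst = (e b).snd := R.faceNext_fst _
  have hf2 : f.snd = (e (b + 1)).snd := hF.link_snd htri le_rfl
  have hfe : ∀ i, f ≠ e i := fun i hi => by
    rw [hi, hF.fst_eq] at hf1
    exact hF.snd_ne _ hf1.symm
  have hfe' : ∀ i, f.symm ≠ e i := fun i hi => by
    have : f.symm.fst = (e (b + 1)).snd := hf2
    rw [hi, hF.fst_eq] at this
    exact hF.snd_ne _ this.symm
  have hee : ∀ i j, (e i).symm ≠ e j := fun i j hij => by
    have : (e i).symm.fst = (e j).fst := by rw [hij]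
    exact hF.snd_ne i (this.trans (hF.fst_eq j))
  -- Only the spokes and the last link `f` receive new values; the earlier links keep those of `δ'`.
  obtain ⟨δ, hanti, hE, hoff⟩ := exists_antisymm_update δ' hδ'.antisymm
    {d | (∃ i ≤ b + 1, d = e i) ∨ d = f}
    (by
      rintro d (⟨i, hi, rfl⟩ | rfl) (⟨j, hj, h⟩ | h)
      · exact hee _ _ h
      · exact hfe' i (by rw [← h, Dart.symm_symm])
      · exact hfe' _ h
      · exact Dart.symm_ne _ h)
    (fun d => if d = f then g (b + 1) - g b else h d)
  have he : ∀ i ≤ b + 1, δ (e i) = g i := fun i hi => by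
    rw [hE _ (Or.inl ⟨i, hi, rfl⟩), if_neg (hfe i).symm, hh i hi]
  have hδf : δ f = g (b + 1) - g b := by
    rw [hE _ (Or.inr rfl), if_pos rfl]
  have hthird : ∀ i ≤ b, δ (R.faceNext (R.faceNext (e i))) = -g (i + 1) := fun i hi => by
    rw [hF.third htri hi, hanti, he _ (by omega)]
  have hlink : ∀ i ≤ b, g i + δ (R.faceNext (e i)) = g (i + 1) := by
    intro i hi
    rcases hi.lt_or_eq with hib | rfl
    · have h1 : (R.faceNext (e i)).fst = (e i).snd := R.faceNext_fst _
      have h2 : (R.faceNext (e i)).snd = (e (i + 1)).snd := hF.link_snd htri hi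
      rw [← gstep i hib, hoff]
      · rintro (⟨j, hj, h⟩ | h)
        · rw [h, hF.fst_eq] at h1
          exact hF.snd_ne _ h1.symm
        · have := hF.injOn hnext htri (by omega) (by omega) (R.faceNext.injective h)
          omega
      · rintro (⟨j, hj, h⟩ | h)
        · have h3 : (R.faceNext (e i)).symm.fst = (e (i + 1)).snd := h2
          rw [h, hF.fst_eq] at h3
          exact hF.snd_ne _ h3.symm
        · have h3 : (R.faceNext (e i)).symm.snd = (e i).snd := h1
          rw [h, hf2] at h3
          have := hF.snd_inj hnext htri (by omega) (by omega) h3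
          omega
    · rw [← hf, hδf]; ring
  -- The only overwritten edges that can have a side in `S'` are the last spoke and the last link;
  -- for these `glast` and `glink` reproduce the value of `δ'`.
  have hagree : ∀ d ∈ S', δ d = δ' d := by
    intro d hd
    obtain ⟨hdS, hdT⟩ := (hS' _).1 hd
    by_cases h1 : ∃ i ≤ b + 1, d = e i
    · obtain ⟨i, hi, rfl⟩ := h1
      rcases hi.lt_or_eq with hib | rfl
      · exact absurd ⟨i, by omega, Or.inl rfl⟩ hdT
      · rw [he _ le_rfl, glast hdS]
    by_cases h2 : d = f
    · exact absurd ⟨b, le_rfl, Or.inr (Or.inl h2)⟩ hdT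
    by_cases h3 : ∃ i ≤ b + 1, d.symm = e i
    · obtain ⟨i, hi, h3⟩ := h3
      obtain rfl : d = (e i).symm := by rw [← h3, Dart.symm_symm]
      rcases i with _ | i
      · exact absurd hdS hF.symm_zero_notMem
      · exact absurd ⟨i, by omega, Or.inr (Or.inr (hF.third htri (by omega)).symm)⟩ hdT
    by_cases h4 : d.symm = f
    · obtain rfl : d = f.symm := by rw [← h4, Dart.symm_symm]
      rw [hanti, hδ'.antisymm, hδf, ← glink hdS]; ring
    · exact hoff d (by rintro (h | h); exacts [h1 h, h2 h]) (by rintro (h | h); exacts [h3 h, h4 h])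
  have hnext' : ∀ d ∈ S', R.faceNext d ∈ S' := fun d hd => by
    obtain ⟨hdS, hdT⟩ := (hS' _).1 hd
    exact (hS' _).2 ⟨hnext _ hdS, hF.faceNext_notMem_fanDarts htri hdS hdT⟩
  have htouch : ∀ v, (∃ d ∈ S', d.fst = v) → ∃ d ∈ S, d.fst = v ∧ δ (R.faceNext d) ≠ 0 := by
    rintro _ ⟨d, hd, rfl⟩
    obtain ⟨d', hd', h1, h2⟩ := hδ'.opposite d hd
    exact ⟨d', ((hS' _).1 hd').1, h1, by rwa [hagree _ (hnext' _ hd')]⟩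
  have hcentre : ∃ d ∈ S, d.fst = (e 0).fst ∧ δ (R.faceNext d) ≠ 0 :=
    ⟨e b, hF.mem b le_rfl, hF.fst_eq b, by rw [← hf, hδf]; exact sub_ne_zero.2 gne⟩
  -- A rim vertex on a surviving edge lies in `S'` and is settled by `δ'`. Otherwise it is an end of
  -- the last link: `(e b).snd` is opposite to the last spoke, and `(e (b + 1)).snd` to spoke `b`,
  -- which is nonzero by `gdead`.
  have hrim : ∀ i ≤ b + 1, ∃ d ∈ S, d.fst = (e i).snd ∧ δ (R.faceNext d) ≠ 0 := by
    intro i hi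
    by_cases hal : i ≤ b ∧ (R.faceNext (e i)).symm ∈ S
    · refine htouch _ ⟨_, hnext' _ (hlink_alive i hal.1 hal.2), ?_⟩
      rw [faceNext_fst]
      exact R.faceNext_fst _
    rcases hi.lt_or_eq with hib | rfl
    · obtain rfl : i = b := by
        by_contra hne
        exact hal ⟨by omega, hF.link_mem i (by omega)⟩
      refine ⟨f, hnext _ (hF.mem i le_rfl), hf1, ?_⟩
      rw [hf, hthird i le_rfl]
      exact neg_ne_zero.2 gb
    · by_cases hla : e (b + 1) ∈ S
      · exact htouch _ ⟨_, hnext' _ (hlast_alive hla), R.faceNext_fst _⟩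
      by_cases hlb : f.symm ∈ S
      · exact htouch _ ⟨_, hlink_alive b le_rfl hlb, hf2⟩
      · refine ⟨R.faceNext f, hnext _ (hnext _ (hF.mem b le_rfl)), by rw [faceNext_fst, hf2], ?_⟩
        rw [hf, htri _ (hF.mem b le_rfl), he b (by omega)]
        exact gdead hlb hla
  refine ⟨δ, hanti, ?_, ?_, ?_⟩
  · intro d hd
    by_cases hdT : d ∈ R.fanDarts e b
    · obtain ⟨i, hi, hdi⟩ := hdT
      have hcl : δ (e i) + δ (R.faceNext (e i)) + δ (R.faceNext (R.faceNext (e i))) = 0 := by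
        rw [he i (by omega), hlink i hi, hthird i hi, add_neg_cancel]
      have hper : R.faceNext (R.faceNext (R.faceNext (e i))) = e i := htri _ (hF.mem i hi)
      rcases hdi with rfl | rfl | rfl
      · exact hcl
      · rw [hper, ← hcl]; ring
      · rw [hper, ← hcl]; ring
    · have hd' : d ∈ S' := (hS' _).2 ⟨hd, hdT⟩
      rw [hagree _ hd', hagree _ (hnext' _ hd'), hagree _ (hnext' _ (hnext' _ hd'))]
      exact hδ'.closed d hd'
  · intro d hd hds
    by_cases hdT : d ∈ R.fanDarts e b
    · obtain ⟨i, hi, rfl | rfl | rfl⟩ := hdT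
      · rcases i with _ | i
        · rwa [he 0 (by omega)]
        · refine absurd ?_ hds
          rw [← hF.third htri (by omega)]
          exact hnext _ (hnext _ (hF.mem i (by omega)))
      · obtain rfl : i = b := by
          by_contra hne
          exact hds (hF.link_mem i (by omega))
        rw [← hf, hδf]
        exact sub_ne_zero.2 gne
      · rw [hF.third htri hi, Dart.symm_symm] at hds
        obtain rfl : i = b := by
          by_contra hne
          exact hds (hF.mem _ (by omega))
        rw [hthird i hi]
        exact neg_ne_zero.2 gb
    · have hd' : d ∈ S' := (hS' _).2 ⟨hd, hdT⟩
      rw [hagree _ hd']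
      exact hδ'.boundary d hd' fun h => hds ((hS' _).1 h).1
  · intro d hd
    by_cases hdT : d ∈ R.fanDarts e b
    · obtain ⟨i, hi, rfl | rfl | rfl⟩ := hdT
      · rw [hF.fst_eq]
        exact hcentre
      · rw [faceNext_fst]
        exact hrim i (by omega)
      · rw [faceNext_fst, hF.link_snd htri hi]
        exact hrim _ (by omega)
    · exact htouch _ ⟨d, (hS' _).2 ⟨hd, hdT⟩, rfl⟩

end Fan

/-- If no nonempty union of triangles of `S` is closed under crossing edges, then `S` carries a
good cochain. -/
theorem exists_isGoodCochain [Finite V] (R : RotationSystem G) (S : Finset G.Dart)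
    (hnext : ∀ d ∈ S, R.faceNext d ∈ S) (htri : ∀ d ∈ S, R.IsTriangularFace d)
    (hbdry : ∀ S' ⊆ S, S'.Nonempty → (∀ d ∈ S', R.faceNext d ∈ S') → ∃ d ∈ S', d.symm ∉ S') :
    ∃ δ, R.IsGoodCochain S δ := by
  classical
  induction S using Finset.strongInduction with
  | H S ih =>
    rcases S.eq_empty_or_nonempty with rfl | hne
    · exact ⟨0, by simp, by simp, by simp, by simp⟩
    obtain ⟨d₀, h₀, h₀'⟩ := hbdry S subset_rfl hne hnext
    obtain ⟨e, b, hF⟩ := R.exists_isFan hnext htri h₀ h₀'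
    have hsub : S.filter (· ∉ R.fanDarts e b) ⊆ S := Finset.filter_subset _ _
    obtain ⟨δ', hδ'⟩ := ih (S.filter (· ∉ R.fanDarts e b))
      (Finset.ssubset_iff_subset_ne.2 ⟨hsub, fun h => by
        have := hF.mem 0 (Nat.zero_le _)
        rw [← h, Finset.mem_filter] at this
        exact this.2 ⟨0, Nat.zero_le _, Or.inl rfl⟩⟩)
      (fun d hd => by
        rw [Finset.mem_filter] at hd ⊢
        exact ⟨hnext _ hd.1, hF.faceNext_notMem_fanDarts htri hd.1 hd.2⟩)
      (fun d hd => htri d (hsub hd))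
      (fun S' hS' => hbdry S' (hS'.trans hsub))
    exact hF.exists_isGoodCochain hnext htri (fun d => Finset.mem_filter) hδ'

/-! ### Faces as orbits of darts -/

/-- The face to the side of a dart. -/
def face (R : RotationSystem G) (d : G.Dart) : R.Face :=
  Quotient.mk (Equiv.Perm.SameCycle.setoid R.faceNext) d

lemma face_eq_iff {R : RotationSystem G} {d e : G.Dart} :
    R.face d = R.face e ↔ R.faceNext.SameCycle d e := Quotient.eq

lemma face_faceNext (R : RotationSystem G) (d : G.Dart) : R.face (R.faceNext d) = R.face d :=
  face_eq_iff.2 (Equiv.Perm.sameCycle_apply_left.2 (Equiv.Perm.SameCycle.refl _ d))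

lemma face_surjective (R : RotationSystem G) : Function.Surjective R.face := Quotient.mk_surjective

lemma exists_lt_of_sameCycle (R : RotationSystem G) {o d : G.Dart} {k : ℕ} (hk : 0 < k)
    (ho : (R.faceNext ^ k) o = o) [Finite G.Dart] (h : R.faceNext.SameCycle o d) :
    ∃ i < k, (R.faceNext ^ i) o = d := by
  obtain ⟨n, -, rfl⟩ := h.exists_pow_eq'
  clear h
  induction n with
  | zero => exact ⟨0, hk, rfl⟩
  | succ n ih =>
    obtain ⟨i, hi, h⟩ := ih
    rw [pow_succ', Equiv.Perm.mul_apply, ← h, ← Equiv.Perm.mul_apply, ← pow_succ']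
    rcases Nat.lt_or_ge (i + 1) k with hik | hik
    · exact ⟨i + 1, hik, rfl⟩
    · obtain rfl : i + 1 = k := by omega
      exact ⟨0, hk, ho.symm⟩

/-- The darts of a face whose boundary walk closes up after `k` steps. -/
lemma filter_face_eq [Fintype G.Dart] [DecidableEq G.Dart] (R : RotationSystem G)
    [DecidableEq R.Face] {o : G.Dart} {k : ℕ} (hk : 0 < k) (ho : (R.faceNext ^ k) o = o) :
    Finset.univ.filter (fun d => R.face d = R.face o) =
      (Finset.range k).image fun i => (R.faceNext ^ i) o := by
  ext d
  simp only [Finset.mem_filter, Finset.mem_univ, true_and, Finset.mem_image, Finset.mem_range]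
  constructor
  · intro h
    exact R.exists_lt_of_sameCycle hk ho (face_eq_iff.1 h.symm)
  · rintro ⟨i, -, rfl⟩
    exact face_eq_iff.2 (Equiv.Perm.sameCycle_pow_left.2 (Equiv.Perm.SameCycle.refl _ _))

/-- The period of `d` divides 3, and it is not 1 because a dart has distinct ends. -/
lemma IsTriangularFace.injOn_pow {R : RotationSystem G} {d : G.Dart} (hd : R.IsTriangularFace d) :
    Set.InjOn (fun i => (R.faceNext ^ i) d) (Finset.range 3 : Finset ℕ) := by
  have h₁ : ∀ e : G.Dart, R.faceNext e ≠ e := fun e he => e.adj.ne' (by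
    rw [← R.faceNext_fst e, he])
  have h₂ : R.faceNext (R.faceNext d) ≠ d := fun h => h₁ d (by
    conv_lhs => rw [← h]
    exact hd)
  intro i hi j hj h
  rw [Finset.coe_range, Set.mem_Iio] at hi hj
  change (R.faceNext ^ i) d = (R.faceNext ^ j) d at h
  interval_cases i <;> interval_cases j <;>
    simp only [pow_zero, pow_one, pow_two, Equiv.Perm.mul_apply, Equiv.Perm.one_apply] at h ⊢
  exacts [absurd h.symm (h₁ _), absurd h.symm h₂, absurd h (h₁ _), absurd h.symm (h₁ _),
    absurd h h₂, absurd h (h₁ _)]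

/-! ### Closed cochains on a plane graph are coboundaries -/

/-- If the ranges of two linear maps are orthogonal and of complementary dimensions, then every
vector which is orthogonal to the second range lies in the first. -/
lemma mem_range_of_dotProduct_eq_zero {K X Y n : Type*} [Field K] [Fintype n] [AddCommGroup X]
    [Module K X] [AddCommGroup Y] [Module K Y] (B : X →ₗ[K] n → K) (T : Y →ₗ[K] n → K)
    (hBT : ∀ x y, T y ⬝ᵥ B x = 0)
    (hcard : Fintype.card n ≤ Module.finrank K B.range + Module.finrank K T.range)
    {v : n → K} (hv : ∀ y, T y ⬝ᵥ v = 0) : v ∈ B.range := by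
  classical
  set W : Submodule K (Module.Dual K (n → K)) :=
    T.range.map (dotProductEquiv K n).toLinearMap with hW
  have hmem : ∀ u, u ∈ W.dualCoannihilator ↔ ∀ y, T y ⬝ᵥ u = 0 := by
    intro u
    rw [Submodule.mem_dualCoannihilator]
    constructor
    · intro h y
      exact h _ ⟨T y, ⟨y, rfl⟩, rfl⟩
    · rintro h _ ⟨_, ⟨y, rfl⟩, rfl⟩
      exact h y
  have hle : B.range ≤ W.dualCoannihilator := by
    rintro _ ⟨x, rfl⟩
    exact (hmem _).2 (hBT x)
  have hdim := Subspace.finrank_add_finrank_dualCoannihilator_eq W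
  have hWdim : Module.finrank K W = Module.finrank K T.range :=
    LinearEquiv.finrank_map_eq (dotProductEquiv K n) T.range
  rw [Module.finrank_fintype_fun_eq_card] at hdim
  rw [Submodule.eq_of_le_of_finrank_le hle (by omega), hmem]
  exact hv

/-- Reversing all darts negates the sum, so twice the sum is zero. -/
lemma sum_dart_eq_zero_of_antisymm [Fintype G.Dart] {K : Type*} [Field K] (h2 : (2 : K) ≠ 0)
    {δ w : G.Dart → K} (hδ : ∀ d, δ d.symm = -δ d) (hw : ∀ d, w d.symm = w d) :
    ∑ d, w d * δ d = 0 := by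
  have h : ∑ d, w d * δ d = -∑ d, w d * δ d := by
    rw [← Finset.sum_neg_distrib]
    refine (Equiv.sum_comp (Function.Involutive.toPerm _ Dart.symm_involutive) _).symm.trans ?_
    refine Finset.sum_congr rfl fun d _ => ?_
    change w d.symm * δ d.symm = _
    rw [hδ, hw, mul_neg]
  have h' : (2 : K) * ∑ d, w d * δ d = 0 := by linear_combination h
  exact (mul_eq_zero.1 h').resolve_left h2

/-- If `δ` sums to zero along each face on which `w` is nonzero, and these faces are triangles, then
`δ` is orthogonal to `w`. -/
lemma sum_dart_eq_zero_of_closed [Fintype G.Dart] (R : RotationSystem G) {K : Type*} [Field K]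
    {δ : G.Dart → K} {w : R.Face → K}
    (hδ : ∀ d : G.Dart, w (R.face d) ≠ 0 → R.IsTriangularFace d ∧
      δ d + δ (R.faceNext d) + δ (R.faceNext (R.faceNext d)) = 0) :
    ∑ d, w (R.face d) * δ d = 0 := by
  classical
  have : Fintype R.Face := Quotient.fintype _
  rw [← Finset.sum_fiberwise Finset.univ
    R.face]
  refine Finset.sum_eq_zero fun F _ => ?_
  obtain ⟨d, rfl⟩ := R.face_surjective F
  rw [Finset.sum_congr rfl (g := fun e => w (R.face d) * δ e)
    (fun e he => by rw [(Finset.mem_filter.1 he).2]), ← Finset.mul_sum]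
  by_cases hw : w (R.face d) = 0
  · rw [hw, zero_mul]
  obtain ⟨htri, hsum⟩ := hδ d hw
  have hfilter : Finset.univ.filter (fun e : G.Dart => R.face e = R.face d) =
      (Finset.range 3).image fun i => (R.faceNext ^ i) d :=
    R.filter_face_eq (by omega) htri
  rw [hfilter, Finset.sum_image htri.injOn_pow, Finset.sum_range_succ, Finset.sum_range_succ,
    Finset.sum_range_one]
  exact (congrArg _ hsum).trans (mul_zero _)

/-- In a plane embedding of a connected graph, an antisymmetric function on darts which sums to zero
along all faces but one, these being triangles, is a coboundary. -/
theorem IsPlanar.exists_eq_sub [Finite V] {R : RotationSystem G} (hR : R.IsPlanar)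
    (hG : G.Connected) (o : G.Dart)
    (htri : ∀ d : G.Dart, ¬ R.faceNext.SameCycle o d → R.IsTriangularFace d)
    {K : Type*} [Field K] (h2 : (2 : K) ≠ 0) {δ : G.Dart → K} (hanti : ∀ d, δ d.symm = -δ d)
    (hclosed : ∀ d : G.Dart, ¬ R.faceNext.SameCycle o d →
      δ d + δ (R.faceNext d) + δ (R.faceNext (R.faceNext d)) = 0) :
    ∃ c : V → K, ∀ d : G.Dart, δ d = c d.snd - c d.fst := by
  classical
  have : Fintype V := Fintype.ofFinite V
  have : Fintype R.Face := Quotient.fintype _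
  -- `B` is the coboundary map. The range of `T` is spanned by the indicators of faces and of edges,
  -- so being orthogonal to it means being antisymmetric with sum zero along every face.
  let B : (V → K) →ₗ[K] G.Dart → K :=
    { toFun := fun c d => c d.snd - c d.fst
      map_add' := fun c c' => by ext d; simp only [Pi.add_apply]; ring
      map_smul' := fun a c => by
        ext d
        simp only [Pi.smul_apply, smul_eq_mul, RingHom.id_apply]
        ring }
  let T : ((R.Face → K) × (G.edgeSet → K)) →ₗ[K] G.Dart → K :=
    { toFun := fun y d => y.1 (R.face d) + y.2 ⟨d.edge, d.edge_mem⟩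
      map_add' := fun y y' => by ext d; simp only [Prod.fst_add, Prod.snd_add, Pi.add_apply]; ring
      map_smul' := fun a y => by
        ext d
        simp only [Prod.smul_fst, Prod.smul_snd, Pi.smul_apply, smul_eq_mul, RingHom.id_apply]
        ring }
  have hTdot : ∀ (y) (η : G.Dart → K), (∀ d, η d.symm = -η d) →
      T y ⬝ᵥ η = ∑ d, y.1 (R.face d) * η d := by
    intro y η hη
    have h0 : ∑ d : G.Dart, y.2 ⟨d.edge, d.edge_mem⟩ * η d = 0 :=
      sum_dart_eq_zero_of_antisymm h2 hη fun d => by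
        simp only [Dart.edge_symm]
    change ∑ d, (y.1 (R.face d) + y.2 ⟨d.edge, d.edge_mem⟩) * η d = _
    simp only [add_mul, Finset.sum_add_distrib, h0, add_zero]
  have hBT : ∀ c y, T y ⬝ᵥ B c = 0 := by
    intro c y
    rw [hTdot y (B c) fun d => by change c d.fst - c d.snd = -(c d.snd - c d.fst); ring]
    change ∑ d : G.Dart, y.1 (R.face d) * (c d.snd - c d.fst) = 0
    simp only [mul_sub, Finset.sum_sub_distrib]
    -- Reindexing along the facial walk keeps the face and turns tails into heads, so the two sums
    -- cancel.
    rw [sub_eq_zero, ← Equiv.sum_comp R.faceNext fun d : G.Dart => y.1 (R.face d) * c d.fst]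
    refine Finset.sum_congr rfl fun d _ => ?_
    rw [R.face_faceNext, R.faceNext_fst]
  have hδT : ∀ y, T y ⬝ᵥ δ = 0 := by
    intro y
    rw [hTdot y δ hanti]
    set a := y.1 (R.face o) with ha
    -- Subtracting the constant `a` changes nothing, since antisymmetry makes the total sum of `δ`
    -- vanish; it removes the outer face, where closedness is not assumed.
    have h1 : ∑ d : G.Dart, (y.1 (R.face d) - a) * δ d = 0 := by
      refine R.sum_dart_eq_zero_of_closed (w := fun F => y.1 F - a) fun d hd => ?_
      have : ¬ R.faceNext.SameCycle o d := fun h => hd (sub_eq_zero.2 (by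
        rw [ha, face_eq_iff.2 h]))
      exact ⟨htri d this, hclosed d this⟩
    have h3 : ∑ d : G.Dart, a * δ d = 0 :=
      sum_dart_eq_zero_of_antisymm h2 (w := fun _ => a) hanti fun _ => rfl
    simpa [sub_mul, Finset.sum_sub_distrib, h3] using h1
  have hkerB : Module.finrank K B.ker ≤ 1 := by
    refine finrank_le_one ⟨fun _ => 1, ?_⟩ ?_
    · ext d; exact sub_self 1
    · rintro ⟨c, hc⟩
      refine ⟨c o.fst, Subtype.ext (funext fun v => ?_)⟩
      have hstep : ∀ u v, G.Walk u v → c u = c v := by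
        intro u v p
        induction p with
        | nil => rfl
        | cons h p ih =>
          rw [← ih]
          exact (sub_eq_zero.1 (congrFun hc ⟨(_, _), h⟩)).symm
      obtain ⟨p⟩ := hG.preconnected o.fst v
      change c o.fst * 1 = c v
      rw [mul_one, hstep _ _ p]
  have hkerT : Module.finrank K T.ker ≤ 1 := by
    refine finrank_le_one ⟨(fun _ => 1, fun _ => -1), ?_⟩ ?_
    · ext d; exact add_neg_cancel 1
    · rintro ⟨⟨f, g⟩, hfg⟩
      have hfg' : ∀ d : G.Dart, f (R.face d) + g ⟨d.edge, d.edge_mem⟩ = 0 := congrFun hfg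
      -- The faces on both sides of an edge carry the same value, the negative of `g` at that edge;
      -- connectedness then makes `f` constant.
      have hconst : ∀ d : G.Dart, f (R.face d) = f (R.face o) := by
        refine R.forall_dart_of_invariant hG (d₀ := o) (fun d hd => ?_) (fun d hd => ?_) rfl
        · rw [← hd, eq_neg_of_add_eq_zero_left (hfg' d),
            eq_neg_of_add_eq_zero_left (hfg' d.symm)]
          simp only [Dart.edge_symm]
        · rw [← hd]
          exact congrArg f (R.face_faceNext d)
      refine ⟨f (R.face o), Subtype.ext (Prod.ext (funext fun F => ?_)
        (funext fun ε => ?_))⟩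
      · obtain ⟨d, rfl⟩ := R.face_surjective F
        change _ * 1 = f (R.face d)
        rw [mul_one]
        exact (hconst d).symm
      · obtain ⟨ε, hε⟩ := ε
        induction ε with
        | h u v =>
          have := hfg' ⟨(u, v), hε⟩
          rw [hconst] at this
          change _ * -1 = g _
          rw [mul_neg, mul_one]
          exact neg_eq_of_add_eq_zero_right this
  have hrB := B.finrank_range_add_finrank_ker
  have hrT := T.finrank_range_add_finrank_ker
  rw [Module.finrank_fintype_fun_eq_card] at hrB
  rw [Module.finrank_prod, Module.finrank_fintype_fun_eq_card,
    Module.finrank_fintype_fun_eq_card] at hrT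
  have hEuler : Fintype.card V + Fintype.card R.Face = Fintype.card G.edgeSet + 2 := by
    simpa only [IsPlanar, Nat.card_eq_fintype_card] using hR
  have hdart := G.dart_card_eq_twice_card_edges
  rw [← G.card_edgeSet] at hdart
  -- The ranks are at least |V| - 1 and |F| + |E| - 1; by Euler's formula these add up to 2|E|, the
  -- number of darts.
  obtain ⟨c, hc⟩ := mem_range_of_dotProduct_eq_zero B T hBT (v := δ)
    (by rw [hdart]; omega) hδT
  exact ⟨c, fun d => (congrFun hc d).symm⟩

end RotationSystem

/-! ### The colouring and the lower bound -/

/-- A triangulated disc has a colouring of its vertices with three colours such that no open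
neighbourhood is monochromatic. -/
theorem IsTriangulatedDisc.exists_coloring {V : Type*} [Finite V] {G : SimpleGraph V}
    (hG : G.IsTriangulatedDisc) :
    ∃ c : V → ZMod 3, ∀ v, ∃ y z, G.Adj v y ∧ G.Adj v z ∧ c y ≠ c z := by
  classical
  have : Fintype V := Fintype.ofFinite V
  obtain ⟨hconn, hcard, R, hplanar, o, hsimple, htri⟩ := hG
  set S : Finset G.Dart := Finset.univ.filter fun d => ¬ R.faceNext.SameCycle o d with hS
  have hmem : ∀ d, d ∈ S ↔ ¬ R.faceNext.SameCycle o d := fun d => by simp [hS]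
  have hnext : ∀ d ∈ S, R.faceNext d ∈ S := fun d hd => by
    rw [hmem] at hd ⊢
    rwa [Equiv.Perm.sameCycle_apply_right]
  obtain ⟨δ, hδ⟩ := R.exists_isGoodCochain S hnext (fun d hd => htri d ((hmem d).1 hd)) (by
    rintro S' hS' ⟨d, hd⟩ hnext'
    -- A set of darts closed under both reversal and the facial walk would contain every dart, in
    -- particular the outer dart `o`.
    by_contra! hcon
    exact (hmem o).1 (hS' (R.forall_dart_of_invariant hconn (P := (· ∈ S')) hcon hnext' hd o))
      (Equiv.Perm.SameCycle.refl _ _))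
  obtain ⟨c, hc⟩ := hplanar.exists_eq_sub hconn o htri (by decide) hδ.antisymm
    fun d hd => hδ.closed d ((hmem d).2 hd)
  have hvertex : ∀ v, ∃ d : G.Dart, d.fst = v := by
    intro v
    have : Nontrivial V := Finite.one_lt_card_iff_nontrivial.1 (by omega)
    obtain ⟨w, hw⟩ := hconn.preconnected.exists_adj_of_nontrivial v
    exact ⟨⟨(v, w), hw⟩, rfl⟩
  -- If all darts at `v` were outer, simplicity of the outer face would leave just one, `d`. The
  -- outer walk then returns along `d.symm`, and simplicity at the other end makes the whole graph a
  -- single edge, against `hcard`.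
  have htouch : ∀ v, ∃ d ∈ S, d.fst = v := by
    intro v
    by_contra! hcon
    have hout : ∀ d : G.Dart, d.fst = v → R.faceNext.SameCycle o d := fun d hd => by
      by_contra h
      exact hcon d ((hmem d).2 h) hd
    obtain ⟨d, hd⟩ := hvertex v
    have hrot : R.rot d = d := hsimple _ _ (hout _ ((R.rot_fst d).trans hd)) (hout d hd)
      (R.rot_fst d)
    have h1 : R.faceNext d.symm = d := by rw [R.faceNext_apply, Dart.symm_symm, hrot]
    have h2 : R.faceNext.SameCycle o d.symm := by
      rw [← Equiv.Perm.sameCycle_apply_right, h1]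
      exact hout d hd
    have h3 : R.faceNext d = d.symm :=
      hsimple _ _ (Equiv.Perm.sameCycle_apply_right.2 (hout d hd)) h2 (R.faceNext_fst d)
    have hall : ∀ e : G.Dart, e = d ∨ e = d.symm := by
      refine R.forall_dart_of_invariant hconn (d₀ := d) ?_ ?_ (Or.inl rfl)
      · rintro e (rfl | rfl)
        · exact Or.inr rfl
        · exact Or.inl (Dart.symm_symm d)
      · rintro e (rfl | rfl)
        · exact Or.inr h3
        · exact Or.inl h1
    have hsub : (Finset.univ : Finset V) ⊆ {d.fst, d.snd} := by
      intro w _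
      obtain ⟨e, rfl⟩ := hvertex w
      rcases hall e with rfl | rfl <;> simp
    have := (Finset.card_le_card hsub).trans Finset.card_le_two
    rw [Finset.card_univ, ← Nat.card_eq_fintype_card] at this
    omega
  refine ⟨c, fun v => ?_⟩
  obtain ⟨d, hd, rfl⟩ := htouch v
  obtain ⟨e, he, hed, hne⟩ := hδ.opposite d hd
  -- The witnesses are the ends of the edge opposite to the vertex in the triangle of `e`.
  refine ⟨e.snd, (R.faceNext e).snd, hed ▸ e.adj, ?_, ?_⟩
  · have h := (htri e ((hmem e).1 he)).faceNext_faceNext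
    have h1 : (R.faceNext e).snd = (R.rot.symm e).snd := by
      rw [← R.faceNext_fst, h]; rfl
    have h2 := (R.rot.symm e).adj
    rwa [R.rot_symm_fst, hed, ← h1] at h2
  · intro h
    apply hne
    rw [hc, R.faceNext_fst, h, sub_self]

/-- The family consists of the complements of the colour classes. A neighbourhood with two colours
meets each complement, and a vertex misses only the complement of its own class. -/
theorem IsTriangulatedDisc.three_halves_le_fractionalTotalDomaticNumber {V : Type*} [Fintype V]
    [DecidableEq V] {G : SimpleGraph V} (hG : G.IsTriangulatedDisc) :
    3 / 2 ≤ G.fractionalTotalDomaticNumber := by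
  obtain ⟨c, hc⟩ := hG.exists_coloring
  set F : Multiset (Finset V) :=
    (Finset.univ : Finset (ZMod 3)).val.map fun i => Finset.univ.filter fun v => c v ≠ i with hF
  have hcardF : Multiset.card F = 3 := by
    rw [hF, Multiset.card_map]; rfl
  have hdist : G.IsThoroughlyDistributed F := by
    refine ⟨fun h => by rw [h] at hcardF; simp at hcardF, fun S hS v => ?_⟩
    obtain ⟨i, -, rfl⟩ := Multiset.mem_map.1 hS
    obtain ⟨y, z, hy, hz, hyz⟩ := hc v
    by_cases h : c y = i
    · exact ⟨z, by simpa using fun h' => hyz (h.trans h'.symm), hz⟩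
    · exact ⟨y, by simpa using h, hy⟩
  have hmax : maxAppearances F ≤ 2 := by
    refine Finset.sup_le fun v _ => ?_
    have key : ∀ a : ZMod 3, (Finset.univ.filter fun i : ZMod 3 => a ≠ i).card ≤ 2 := by decide
    rw [hF, Multiset.countP_map]
    simpa [Finset.card_def] using key (c v)
  refine le_iSup₂_of_le F hdist ?_
  rw [hcardF]
  have : ((maxAppearances F : ℕ) : ℝ≥0∞) ≤ 2 := by exact_mod_cast hmax
  exact ENNReal.div_le_div_left this _

/-! ### The extremal graphs and their rotation -/

namespace SeparatedSun

/-- Adjacency of the graphs which show that the bound is attained. The vertices `0, …, N + 5` form a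
path; `N + 5` is adjacent to all of them, `N + 3` to `1, …, N + 2`, and `N + 6` to `1`
and `N + 3`. The triangle with vertices `1`, `N + 3`, `N + 5` has ears at `0`, `N + 4`, `N + 6`. -/
def Adj (N x y : ℕ) : Prop :=
  ((y = x + 1 ∧ y ≤ N + 5) ∨ (y = N + 5 ∧ x ≤ N + 3) ∨ (y = N + 3 ∧ 1 ≤ x ∧ x ≤ N + 1) ∨
    (y = N + 6 ∧ (x = 1 ∨ x = N + 3))) ∨
  ((x = y + 1 ∧ x ≤ N + 5) ∨ (x = N + 5 ∧ y ≤ N + 3) ∨ (x = N + 3 ∧ 1 ≤ y ∧ y ≤ N + 1) ∨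
    (x = N + 6 ∧ (y = 1 ∨ y = N + 3)))

instance (N x y : ℕ) : Decidable (Adj N x y) := by unfold Adj; infer_instance

/-- The neighbour which follows `y` in the rotation at `x`. -/
def next (N x y : ℕ) : ℕ :=
  if x = N + 5 then if y = 0 then N + 4 else y - 1
  else if x = N + 3 then
    if y = N + 6 then 1 else if y ≤ N + 1 then y + 1 else if y = N + 2 then N + 5
    else if y = N + 5 then N + 4 else N + 6
  else if x = 0 then if y = 1 then N + 5 else 1
  else if x = N + 4 then if y = N + 5 then N + 3 else N + 5
  else if x = N + 6 then if y = 1 then N + 3 else 1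
  else if y = N + 5 then x + 1
  else if y = N + 3 then if x = 1 then N + 6 else x - 1
  else if y = x + 1 then N + 3
  else if y = N + 6 then 0
  else N + 5

/-- A number which decreases along the rotation at `x`, except at the neighbour `last N x`. -/
def rank (N x y : ℕ) : ℕ :=
  if x = N + 5 then y
  else if x = N + 3 then
    if y ≤ N + 2 then N + 9 - y else if y = N + 5 then 2 else if y = N + 4 then 1 else 0
  else if x = 0 then if y = 1 then 1 else 0
  else if x = N + 4 then if y = N + 5 then 1 else 0
  else if x = N + 6 then if y = 1 then 0 else 1
  else if y = N + 6 then 0 else if y = N + 3 then 1 else if y = x + 1 then 2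
  else if y = N + 5 then 3 else 4

/-- See `rank`. -/
def last (N x : ℕ) : ℕ :=
  if x = N + 5 then 0 else if x = N + 3 then N + 6 else if x = 0 then N + 5
  else if x = N + 4 then N + 3 else if x = N + 6 then 1 else if x = 1 then N + 6 else N + 3

/-- The darts of the outer face. -/
def Outer (N x y : ℕ) : Prop :=
  (x = 0 ∧ y = N + 5) ∨ (x = N + 5 ∧ y = N + 4) ∨ (x = N + 4 ∧ y = N + 3) ∨
    (x = N + 3 ∧ y = N + 6) ∨ (x = N + 6 ∧ y = 1) ∨ (x = 1 ∧ y = 0)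

/-- The rotation at `x` takes `y` to `z`. -/
inductive Step (N : ℕ) : ℕ → ℕ → ℕ → Prop
  | a0 : Step N (N + 5) 0 (N + 4)
  | a (j : ℕ) (hj : j ≤ N + 3) : Step N (N + 5) (j + 1) j
  | b1 : Step N (N + 3) (N + 6) 1
  | b2 (y : ℕ) (h1 : 1 ≤ y) (h2 : y ≤ N + 1) : Step N (N + 3) y (y + 1)
  | b3 : Step N (N + 3) (N + 2) (N + 5)
  | b4 : Step N (N + 3) (N + 5) (N + 4)
  | b5 : Step N (N + 3) (N + 4) (N + 6)
  | c1 : Step N 0 1 (N + 5)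
  | c2 : Step N 0 (N + 5) 1
  | d1 : Step N (N + 4) (N + 5) (N + 3)
  | d2 : Step N (N + 4) (N + 3) (N + 5)
  | e1 : Step N (N + 6) 1 (N + 3)
  | e2 : Step N (N + 6) (N + 3) 1
  | p1 (x : ℕ) (h : x ≤ N + 1) : Step N (x + 1) (N + 5) (x + 2)
  | p2 (x : ℕ) (h : x ≤ N) : Step N (x + 1) (x + 2) (N + 3)
  | p3 (x : ℕ) (h1 : x ≤ N) : Step N (x + 2) (N + 3) (x + 1)
  | p4 (x : ℕ) (h : x ≤ N + 1) : Step N (x + 1) x (N + 5)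
  | p5 : Step N 1 (N + 3) (N + 6)
  | p6 : Step N 1 (N + 6) 0

variable {N x y z w : ℕ}

/-- `Step` lists the values of `next` case by case with linear side conditions, which reduces the
local checks below to linear arithmetic. -/
lemma Step.next_eq (h : Step N x y z) : next N x y = z := by
  cases h <;> unfold next <;> grind

lemma Adj.step (h : Adj N x y) : ∃ z, Step N x y z := by
  unfold Adj at h
  rcases h with (⟨rfl, h1⟩ | ⟨rfl, h1⟩ | ⟨rfl, h1, h2⟩ | ⟨rfl, rfl | rfl⟩) |
    (⟨rfl, h1⟩ | ⟨rfl, h1⟩ | ⟨rfl, h1, h2⟩ | ⟨rfl, rfl | rfl⟩)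
  · rcases x with _ | x
    · exact ⟨_, .c1⟩
    obtain h | h | h | h : x ≤ N ∨ x = N + 1 ∨ x = N + 2 ∨ x = N + 3 := by omega
    · exact ⟨_, .p2 x h⟩
    · subst h; exact ⟨_, .p3 N le_rfl⟩
    · subst h; exact ⟨_, .b5⟩
    · subst h; exact ⟨_, .d1⟩
  · rcases x with _ | x
    · exact ⟨_, .c2⟩
    obtain h | h : x ≤ N + 1 ∨ x = N + 2 := by omega
    · exact ⟨_, .p1 x h⟩
    · subst h; exact ⟨_, .b4⟩
  · rcases x with _ | _ | x
    · omega
    · exact ⟨_, .p5⟩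
    · exact ⟨_, .p3 x (by omega)⟩
  · exact ⟨_, .p6⟩
  · exact ⟨_, .b1⟩
  · obtain h | h | h | h : y ≤ N + 1 ∨ y = N + 2 ∨ y = N + 3 ∨ y = N + 4 := by omega
    · exact ⟨_, .p4 y h⟩
    · subst h; exact ⟨_, .b3⟩
    · subst h; exact ⟨_, .d2⟩
    · subst h; exact ⟨_, .a _ le_rfl⟩
  · rcases y with _ | y
    · exact ⟨_, .a0⟩
    · exact ⟨_, .a y (by omega)⟩
  · exact ⟨_, .b2 y h1 h2⟩
  · exact ⟨_, .e1⟩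
  · exact ⟨_, .e2⟩

lemma Step.adj (h : Step N x y z) : Adj N x z := by
  cases h <;> unfold Adj <;> omega

lemma Step.inj (h : Step N x y z) (h' : Step N x w z) : y = w := by
  generalize hx : x = x', hz : z = z' at h'
  cases h <;> cases h' <;> omega

lemma Step.rank_lt (h : Step N x y z) (hy : y ≠ last N x) : rank N x z < rank N x y := by
  cases h <;> unfold last at hy <;> unfold rank <;> grind

/-- The facial walk goes from `y` to `x`, then to `z`, then to `w`; the equality closes the
triangle. -/
lemma Step.third (h : Step N x y z) (h' : Step N z x w) (ho : ¬ Outer N y x) : w = y := by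
  generalize hx : x = x', hz : z = z' at h'
  unfold Outer at ho
  cases h <;> cases h' <;> omega

lemma Step.not_outer (h : Step N x y z) (ho : ¬ Outer N y x) : ¬ Outer N x z := by
  unfold Outer at *
  cases h <;> omega

lemma Adj.symm (h : Adj N x y) : Adj N y x := Or.symm h

lemma Adj.step_next (h : Adj N x y) : Step N x y (next N x y) := by
  obtain ⟨z, hz⟩ := h.step
  rwa [hz.next_eq]

lemma Adj.lt_right (h : Adj N x y) : y < N + 7 := by unfold Adj at h; omega

lemma Adj.ne (h : Adj N x y) : x ≠ y := by unfold Adj at h; omega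

end SeparatedSun

open SeparatedSun

/-- A triangle with an ear on each side and with further vertices in its interior, see
`SeparatedSun.Adj`. -/
def separatedSun (N : ℕ) : SimpleGraph (Fin (N + 7)) where
  Adj x y := SeparatedSun.Adj N x y
  symm := ⟨fun _ _ h => SeparatedSun.Adj.symm h⟩
  loopless := ⟨fun _ h => h.ne rfl⟩

namespace SeparatedSun

variable {N : ℕ}

instance : DecidableRel (separatedSun N).Adj := fun x y =>
  inferInstanceAs (Decidable (SeparatedSun.Adj N x y))

/-- The rotation, as a map on darts. -/
def rotFun (d : (separatedSun N).Dart) : (separatedSun N).Dart where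
  fst := d.fst
  snd := ⟨next N d.fst d.snd, d.adj.step_next.adj.lt_right⟩
  adj := d.adj.step_next.adj

lemma dart_ext {d e : (separatedSun N).Dart} (h₁ : (d.fst : ℕ) = e.fst) (h₂ : (d.snd : ℕ) = e.snd) :
    d = e :=
  Dart.ext _ _ (Prod.ext (Fin.ext h₁) (Fin.ext h₂))

lemma rotFun_injective : Function.Injective (rotFun (N := N)) := by
  intro d e h
  have h₁ : (rotFun d).fst = (rotFun e).fst := by rw [h]
  change d.fst = e.fst at h₁
  have h₂ : ((rotFun d).snd : ℕ) = (rotFun e).snd := by rw [h]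
  change next N d.fst d.snd = next N e.fst e.snd at h₂
  refine dart_ext (congrArg _ h₁) ?_
  have := SeparatedSun.Adj.step_next e.adj
  rw [← h₂, ← h₁] at this
  exact (SeparatedSun.Adj.step_next d.adj).inj this

/-- A plane embedding of the graph. -/
noncomputable def rotation (N : ℕ) : RotationSystem (separatedSun N) where
  rot := Equiv.ofBijective rotFun (Finite.injective_iff_bijective.1 rotFun_injective)
  rot_fst _ := rfl
  rot_sameCycle := by
    let σ : Equiv.Perm (separatedSun N).Dart :=
      Equiv.ofBijective rotFun (Finite.injective_iff_bijective.1 rotFun_injective)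
    -- Following the rotation lowers the rank until the neighbour `last` is reached, so all darts at
    -- a vertex share a cycle with the dart towards `last`.
    have key : ∀ k (d : (separatedSun N).Dart), rank N d.fst d.snd ≤ k →
        ∃ e : (separatedSun N).Dart, σ.SameCycle d e ∧ e.fst = d.fst ∧
          (e.snd : ℕ) = last N d.fst := by
      intro k
      induction k with
      | zero =>
        intro d hd
        refine ⟨d, .refl _ _, rfl, by_contra fun hne => ?_⟩
        have := d.adj.step_next.rank_lt hne
        omega
      | succ k ih =>
        intro d hd
        by_cases hne : (d.snd : ℕ) = last N d.fst
        · exact ⟨d, .refl _ _, rfl, hne⟩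
        · have := d.adj.step_next.rank_lt hne
          obtain ⟨e, h₁, h₂, h₃⟩ := ih (rotFun d) (by
            change rank N d.fst (next N d.fst d.snd) ≤ k
            omega)
          exact ⟨e, Equiv.Perm.sameCycle_apply_left.1 h₁, h₂, h₃⟩
    intro d e hde
    obtain ⟨d', h₁, h₂, h₃⟩ := key _ d le_rfl
    obtain ⟨e', h₄, h₅, h₆⟩ := key _ e le_rfl
    obtain rfl : d' = e' := dart_ext (by rw [h₂, h₅, hde]) (by rw [h₃, h₆, hde])
    exact h₁.trans h₄.symm

lemma step_faceNext (d : (separatedSun N).Dart) :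
    Step N d.snd d.fst ((rotation N).faceNext d).snd :=
  SeparatedSun.Adj.step_next d.symm.adj

lemma isTriangularFace {d : (separatedSun N).Dart} (hd : ¬ Outer N d.fst d.snd) :
    (rotation N).IsTriangularFace d := by
  have h₁ := step_faceNext d
  have h₂ := step_faceNext ((rotation N).faceNext d)
  have h₃ := step_faceNext ((rotation N).faceNext ((rotation N).faceNext d))
  rw [RotationSystem.faceNext_fst] at h₂
  rw [RotationSystem.faceNext_fst] at h₃
  have h₄ := h₁.third h₂ hd
  refine dart_ext ?_ ?_
  · rw [RotationSystem.faceNext_fst, h₄]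
  · exact h₂.third h₃ (h₁.not_outer hd)

/-- The dart of the outer face with which we start. -/
def outerDart (N : ℕ) : (separatedSun N).Dart where
  fst := ⟨0, by omega⟩
  snd := ⟨N + 5, by omega⟩
  adj := by change SeparatedSun.Adj N 0 (N + 5); unfold SeparatedSun.Adj; omega

/-- The vertices of the outer face. -/
def outerVertex (N i : ℕ) : ℕ :=
  if i = 1 then N + 5 else if i = 2 then N + 4 else if i = 3 then N + 3 else if i = 4 then N + 6
  else if i = 5 then 1 else 0

/-- The outer face is a hexagon. The default branch of `outerVertex` covers both index 0 and index
6, and `i % 6` lets the case `i = 6` state that the walk has closed up. -/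
lemma outer_iterate : ∀ i ≤ 6,
    ((((rotation N).faceNext ^ i) (outerDart N)).fst : ℕ) = outerVertex N i ∧
    ((((rotation N).faceNext ^ i) (outerDart N)).snd : ℕ) = outerVertex N (i % 6 + 1) := by
  intro i hi
  induction i with
  | zero => exact ⟨rfl, rfl⟩
  | succ i ih =>
    obtain ⟨h₁, h₂⟩ := ih (by omega)
    have h := step_faceNext (((rotation N).faceNext ^ i) (outerDart N))
    rw [pow_succ', Equiv.Perm.mul_apply, RotationSystem.faceNext_fst]
    rw [h₁, h₂] at h
    rw [h₂]
    refine ⟨by rw [Nat.mod_eq_of_lt (by omega)], h.next_eq.symm.trans ?_⟩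
    have : i < 6 := by omega
    interval_cases i <;> simp [outerVertex, next]

lemma faceNext_pow_six : ((rotation N).faceNext ^ 6) (outerDart N) = outerDart N :=
  dart_ext (outer_iterate 6 le_rfl).1 (outer_iterate 6 le_rfl).2

lemma outerVertex_inj {i j : ℕ} (hi : i < 6) (hj : j < 6)
    (h : outerVertex N i = outerVertex N j) : i = j := by
  unfold outerVertex at h
  split_ifs at h <;> omega

lemma isSimpleFace : (rotation N).IsSimpleFace (outerDart N) := by
  intro d e hd he hde
  obtain ⟨i, hi, rfl⟩ := (rotation N).exists_lt_of_sameCycle (by omega) faceNext_pow_six hd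
  obtain ⟨j, hj, rfl⟩ := (rotation N).exists_lt_of_sameCycle (by omega) faceNext_pow_six he
  rw [outerVertex_inj hi hj ((outer_iterate i hi.le).1.symm.trans
    ((congrArg Fin.val hde).trans (outer_iterate j hj.le).1))]

lemma sameCycle_of_outer {d : (separatedSun N).Dart} (hd : Outer N d.fst d.snd) :
    (rotation N).faceNext.SameCycle (outerDart N) d := by
  have key : ∀ i < 6, (d.fst : ℕ) = outerVertex N i → (d.snd : ℕ) = outerVertex N (i + 1) →
      (rotation N).faceNext.SameCycle (outerDart N) d := by
    intro i hi h₁ h₂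
    have h := outer_iterate (N := N) i hi.le
    rw [Nat.mod_eq_of_lt hi] at h
    have : ((rotation N).faceNext ^ i) (outerDart N) = d :=
      dart_ext (h.1.trans h₁.symm) (h.2.trans h₂.symm)
    rw [← this, Equiv.Perm.sameCycle_pow_right]
  rcases hd with h | h | h | h | h | h
  exacts [key 0 (by omega) h.1 h.2, key 1 (by omega) h.1 h.2, key 2 (by omega) h.1 h.2,
    key 3 (by omega) h.1 h.2, key 4 (by omega) h.1 h.2, key 5 (by omega) h.1 h.2]

lemma connected : (separatedSun N).Connected := by
  have h : ∀ v : Fin (N + 7), (separatedSun N).Reachable v ⟨N + 5, by omega⟩ := by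
    have h₁ : ∀ v : Fin (N + 7), (v : ℕ) ≤ N + 4 →
        (separatedSun N).Reachable v ⟨N + 5, by omega⟩ := fun v hv =>
      SimpleGraph.Adj.reachable (by
        change SeparatedSun.Adj N v (N + 5); unfold SeparatedSun.Adj; omega)
    intro v
    obtain hv | hv | hv : (v : ℕ) ≤ N + 4 ∨ (v : ℕ) = N + 5 ∨ (v : ℕ) = N + 6 := by omega
    · exact h₁ v hv
    · rw [show v = ⟨N + 5, by omega⟩ from Fin.ext hv]
    · refine .trans (v := ⟨1, by omega⟩) (SimpleGraph.Adj.reachable ?_) (h₁ _ (by simp))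
      change SeparatedSun.Adj N v 1
      unfold SeparatedSun.Adj
      omega
  exact { preconnected := fun u v => (h u).trans (h v).symm, nonempty := ⟨⟨0, by omega⟩⟩ }

/-! ### Counting darts and faces: Euler's formula -/

lemma card_filter_adj {x : ℕ} {s : Finset ℕ} (hs : ∀ y, SeparatedSun.Adj N x y ↔ y ∈ s) :
    ((Finset.range (N + 7)).filter (SeparatedSun.Adj N x)).card = s.card := by
  congr 1
  ext y
  rw [Finset.mem_filter, hs, Finset.mem_range, and_iff_right_iff_imp]
  exact fun h => ((hs y).2 h).lt_right

/-- The degrees are 2 at the three ear tips, 4 at `2, …, N + 1`, 5 at `1`, 3 at `N + 2`, and `N + 5`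
at each of `N + 3` and `N + 5`. -/
lemma sum_card_filter_adj (N : ℕ) :
    ∑ x ∈ Finset.range (N + 7), ((Finset.range (N + 7)).filter (SeparatedSun.Adj N x)).card =
      6 * N + 24 := by
  have two : ∀ x a b, a ≠ b → (∀ y, SeparatedSun.Adj N x y ↔ y = a ∨ y = b) →
      ((Finset.range (N + 7)).filter (SeparatedSun.Adj N x)).card = 2 := by
    intro x a b hab h
    rw [card_filter_adj (s := {a, b}) fun y => by simp [h], Finset.card_pair hab]
  have hmid : ∀ x ∈ Finset.range N,
      ((Finset.range (N + 7)).filter (SeparatedSun.Adj N (x + 1 + 1))).card = 4 := by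
    intro x hx
    rw [Finset.mem_range] at hx
    rw [card_filter_adj (s := {x + 1, x + 3, N + 3, N + 5}) fun y => by
      simp only [Finset.mem_insert, Finset.mem_singleton]; unfold SeparatedSun.Adj; omega]
    rw [Finset.card_insert_of_notMem (by simp; omega),
      Finset.card_insert_of_notMem (by simp; omega), Finset.card_pair (by omega)]
  have h0 := two 0 1 (N + 5) (by omega) fun y => by unfold SeparatedSun.Adj; omega
  have h4 := two (N + 4) (N + 3) (N + 5) (by omega) fun y => by unfold SeparatedSun.Adj; omega
  have h6 := two (N + 6) 1 (N + 3) (by omega) fun y => by unfold SeparatedSun.Adj; omega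
  have h1 : ((Finset.range (N + 7)).filter (SeparatedSun.Adj N 1)).card = 5 := by
    rw [card_filter_adj (s := {0, 2, N + 3, N + 5, N + 6}) fun y => by
      simp only [Finset.mem_insert, Finset.mem_singleton]; unfold SeparatedSun.Adj; omega]
    rw [Finset.card_insert_of_notMem (by simp), Finset.card_insert_of_notMem (by simp),
      Finset.card_insert_of_notMem (by simp), Finset.card_pair (by omega)]
  have h2 : ((Finset.range (N + 7)).filter (SeparatedSun.Adj N (N + 2))).card = 3 := by
    rw [card_filter_adj (s := {N + 1, N + 3, N + 5}) fun y => by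
      simp only [Finset.mem_insert, Finset.mem_singleton]; unfold SeparatedSun.Adj; omega]
    rw [Finset.card_insert_of_notMem (by simp), Finset.card_pair (by omega)]
  have h3 : ((Finset.range (N + 7)).filter (SeparatedSun.Adj N (N + 3))).card = N + 5 := by
    rw [card_filter_adj (s := (Finset.Icc 1 (N + 6)).erase (N + 3)) fun y => by
      simp only [Finset.mem_erase, Finset.mem_Icc]; unfold SeparatedSun.Adj; omega]
    rw [Finset.card_erase_of_mem (by simp), Nat.card_Icc]
    omega
  have h5 : ((Finset.range (N + 7)).filter (SeparatedSun.Adj N (N + 5))).card = N + 5 := by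
    rw [card_filter_adj (s := Finset.range (N + 5)) fun y => by
      simp only [Finset.mem_range]; unfold SeparatedSun.Adj; omega, Finset.card_range]
  rw [Finset.sum_range_succ, Finset.sum_range_succ, Finset.sum_range_succ, Finset.sum_range_succ,
    Finset.sum_range_succ, Finset.sum_range_succ', Finset.sum_range_succ',
    Finset.sum_congr rfl hmid, h0, h2, h3, h4, h5, h6, zero_add, h1, Finset.sum_const, Finset.card_range, smul_eq_mul]
  ring

lemma card_dart (N : ℕ) : Fintype.card (separatedSun N).Dart = 6 * N + 24 := by
  rw [dart_card_eq_sum_degrees, ← sum_card_filter_adj, ← Fin.sum_univ_eq_sum_range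
    (fun x => ((Finset.range (N + 7)).filter (SeparatedSun.Adj N x)).card)]
  refine Finset.sum_congr rfl fun x _ => ?_
  rw [← card_neighborFinset_eq_degree, ← Finset.card_map Fin.valEmbedding]
  congr 1
  ext y
  simp only [Finset.mem_map, mem_neighborFinset, Finset.mem_filter, Finset.mem_range]
  constructor
  · rintro ⟨y, h, rfl⟩
    exact ⟨y.2, h⟩
  · rintro ⟨hy, h⟩
    exact ⟨⟨y, hy⟩, h, rfl⟩

/-- One face has six darts and all others three, so the 6N + 24 darts form 2N + 7 faces; there are N
+ 7 vertices and 3N + 12 edges. -/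
lemma isPlanar (N : ℕ) : (rotation N).IsPlanar := by
  classical
  have : Fintype (rotation N).Face := Quotient.fintype _
  have hE := (separatedSun N).dart_card_eq_twice_card_edges
  rw [card_dart, ← card_edgeSet] at hE
  have hF := Finset.card_eq_sum_card_fiberwise (f := (rotation N).face)
    (s := Finset.univ) (t := Finset.univ) (fun _ _ => Finset.mem_univ _)
  rw [Finset.card_univ, card_dart, ← Finset.add_sum_erase _ _
    (Finset.mem_univ ((rotation N).face (outerDart N)))] at hF
  have hinj : Set.InjOn (fun i => ((rotation N).faceNext ^ i) (outerDart N))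
      (Finset.range 6 : Finset ℕ) := by
    intro i hi j hj h
    rw [Finset.coe_range, Set.mem_Iio] at hi hj
    exact outerVertex_inj hi hj ((outer_iterate (N := N) i hi.le).1.symm.trans
      ((congrArg (fun d : (separatedSun N).Dart => (d.fst : ℕ)) h).trans
        (outer_iterate j hj.le).1))
  rw [(rotation N).filter_face_eq (by omega) faceNext_pow_six, Finset.card_image_of_injOn hinj,
    Finset.card_range] at hF
  rw [Finset.sum_congr rfl (g := fun _ => 3), Finset.sum_const,
    Finset.card_erase_of_mem (Finset.mem_univ _), Finset.card_univ, smul_eq_mul] at hF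
  · have hpos : 0 < Fintype.card (rotation N).Face :=
      Fintype.card_pos_iff.2 ⟨(rotation N).face (outerDart N)⟩
    rw [RotationSystem.IsPlanar, Nat.card_eq_fintype_card, Nat.card_eq_fintype_card,
      Nat.card_eq_fintype_card, Fintype.card_fin]
    omega
  · intro F hF'
    obtain ⟨d, rfl⟩ := (rotation N).face_surjective F
    have hd : (rotation N).IsTriangularFace d := isTriangularFace fun h =>
      (Finset.mem_erase.1 hF').1 (RotationSystem.face_eq_iff.2 (sameCycle_of_outer h)).symm
    rw [(rotation N).filter_face_eq (k := 3) (by omega) hd, Finset.card_image_of_injOn hd.injOn_pow,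
      Finset.card_range]

lemma isTriangulatedDisc (N : ℕ) : (separatedSun N).IsTriangulatedDisc := by
  refine ⟨connected, by rw [Nat.card_eq_fintype_card, Fintype.card_fin]; omega, rotation N,
    isPlanar N, outerDart N, isSimpleFace, fun d hd => ?_⟩
  exact isTriangularFace fun h => hd (sameCycle_of_outer h)

end SeparatedSun

/-! ### The upper bound -/

/-- If each total dominating set contains two of three given vertices, then the fractional total
domatic number is at most `3 / 2`. -/
lemma fractionalTotalDomaticNumber_le_three_halves {V : Type*} [Fintype V] [DecidableEq V]
    {G : SimpleGraph V} (a b c : V)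
    (h : ∀ S : Finset V, G.IsTotalDominating S →
      (a ∈ S ∨ b ∈ S) ∧ (a ∈ S ∨ c ∈ S) ∧ (b ∈ S ∨ c ∈ S)) :
    G.fractionalTotalDomaticNumber ≤ 3 / 2 := by
  refine iSup₂_le fun F hF => ?_
  -- Double counting: each set contributes at least two to the appearances of the three vertices,
  -- and each vertex appears at most `maxAppearances F` times.
  have hsum : ∀ F : Multiset (Finset V), (∀ S ∈ F, G.IsTotalDominating S) →
      2 * Multiset.card F ≤ F.countP (a ∈ ·) + F.countP (b ∈ ·) + F.countP (c ∈ ·) := by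
    intro F hF
    induction F using Multiset.induction with
    | empty => simp
    | cons S F ih =>
      have h₁ := ih fun T hT => hF T (Multiset.mem_cons_of_mem hT)
      obtain ⟨h₂, h₃, h₄⟩ := h S (hF S (Multiset.mem_cons_self S F))
      rw [Multiset.card_cons, Multiset.countP_cons, Multiset.countP_cons, Multiset.countP_cons]
      split_ifs <;> first | omega | tauto
  have hmax : ∀ v, F.countP (v ∈ ·) ≤ maxAppearances F := fun v =>
    Finset.le_sup (f := fun v : V => F.countP fun S => v ∈ S) (Finset.mem_univ v)
  have hle : Multiset.card F * 2 ≤ 3 * maxAppearances F := by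
    have := hsum F hF.2
    have := hmax a
    have := hmax b
    have := hmax c
    omega
  refine ENNReal.div_le_of_le_mul ?_
  rw [ENNReal.mul_comm_div, ← mul_div_assoc,
    ENNReal.le_div_iff_mul_le (by simp) (by simp)]
  exact_mod_cast hle

/-- The ear tips `N + 6`, `0` and `N + 4` have as neighbourhoods the three pairs of corners. -/
lemma separatedSun_isTotalDominating {N : ℕ} {S : Finset (Fin (N + 7))}
    (hS : (separatedSun N).IsTotalDominating S) :
    ((⟨1, by omega⟩ : Fin (N + 7)) ∈ S ∨ (⟨N + 3, by omega⟩ : Fin (N + 7)) ∈ S) ∧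
      ((⟨1, by omega⟩ : Fin (N + 7)) ∈ S ∨ (⟨N + 5, by omega⟩ : Fin (N + 7)) ∈ S) ∧
      ((⟨N + 3, by omega⟩ : Fin (N + 7)) ∈ S ∨ (⟨N + 5, by omega⟩ : Fin (N + 7)) ∈ S) := by
  have key : ∀ (x a b : ℕ) (hx : x < N + 7) (ha : a < N + 7) (hb : b < N + 7),
      (∀ y, SeparatedSun.Adj N x y → y = a ∨ y = b) →
      ((⟨a, ha⟩ : Fin (N + 7)) ∈ S ∨ (⟨b, hb⟩ : Fin (N + 7)) ∈ S) := by
    intro x a b hx ha hb h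
    obtain ⟨w, hw, hxw⟩ := hS ⟨x, hx⟩
    rcases h w hxw with h | h
    · exact Or.inl ((Fin.ext h : w = ⟨a, ha⟩) ▸ hw)
    · exact Or.inr ((Fin.ext h : w = ⟨b, hb⟩) ▸ hw)
  refine ⟨key (N + 6) _ _ (by omega) _ _ ?_, key 0 _ _ (by omega) _ _ ?_,
    key (N + 4) _ _ (by omega) _ _ ?_⟩ <;> (intro y hy; unfold SeparatedSun.Adj at hy; omega)

end SimpleGraph

theorem mainTheorem2 :
    (∀ {V : Type*} [Fintype V] [DecidableEq V] (G : SimpleGraph V),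
      G.IsTriangulatedDisc → 3 / 2 ≤ G.fractionalTotalDomaticNumber) ∧
    (∀ N : ℕ, ∃ n : ℕ, N ≤ n ∧ ∃ G : SimpleGraph (Fin n),
      G.IsTriangulatedDisc ∧ G.fractionalTotalDomaticNumber = 3 / 2) := by
  refine ⟨fun G hG => hG.three_halves_le_fractionalTotalDomaticNumber,
    fun N => ⟨N + 7, by omega, SimpleGraph.separatedSun N,
    SimpleGraph.SeparatedSun.isTriangulatedDisc N, le_antisymm ?_ ?_⟩⟩
  · exact SimpleGraph.fractionalTotalDomaticNumber_le_three_halves _ _ _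
      fun S hS => SimpleGraph.separatedSun_isTotalDominating hS
  · exact
      (SimpleGraph.SeparatedSun.isTriangulatedDisc N).three_halves_le_fractionalTotalDomaticNumber
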